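/- **Theorem (Schützenberger–McNaughton–Papert–Kamp).** Let $\Sigma$ be a finite nonempty alphabet and let $L \subseteq \Sigma^*$ be a language of finite words. The following conditions are equivalent: 1. $L$ is recognised by a finite aperiodic monoid, i.e. there are a finite monoid $M$, a monoid homomorphism $h : \Sigma^* \to M$ and a subset $F \subseteq M$ such that $w \in L \iff h(w) \in F$ for every $w \in \Sigma^*$, and $M$ is aperiodic: every $a \in M$ satisfies $a^{n} = a^{n} a$, where $n \ge 1$ is an exponent for which $a^n$ is idempotent. 2. $L$ is star-free, i.e. it is described by an expression built from single letters $a \in \Sigma$ (denoting the language $\{a\}$) and the empty language $\emptyset$ by means of concatenation, union and complementation with respect to $\Sigma^*$. 3. $L$ is first-order definable in the ordered model, i.e. there is a first-order sentence $\varphi$ (with equality) over the vocabulary consisting of a binary relation $x \le y$ and a unary relation $a(x)$ for each $a \in \Sigma$, such that a word $w \in \Sigma^*$ belongs to $L$ if and only if $\varphi$ is true in the model whose universe is the set of positions of $w$ (empty for the empty word), where $\le$ is the order on positions and $a(x)$ says that position $x$ has label $a$. 4. $L$ is definable in linear temporal logic, i.e. there is a formula $\varphi$ of the grammar $a \in \Sigma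 \mid \varphi \land \psi \mid \varphi \lor \psi \mid \neg \varphi \mid \varphi \,\mathsf{U}\, \psi$ such that every nonempty word $w \in \Sigma^+$ belongs to $L$ if and only if $\varphi$ is true at the first position of $w$ (the empty word is not taken into account). Here the formula $a$ is true at the positions with label $a$, Boolean connectives are interpreted as usual, and until is strict: $w, x \models \varphi \,\mathsf{U}\, \psi$ if and only if there is a position $y > x$ with $w, y \models \psi$ such that $w, z \models \varphi$ for all positions $z$ with $x < z < y$. -/

import Mathlib

universe u v

namespace WordLogic

/-! ### Recognition by finite aperiodic monoids -/

/-- For every `a`, the idempotent power `a ^ n` (with `n ≥ 1`) of `a` satisfies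
`a ^ n = a ^ n * a`. -/
def IsAperiodic (M : Type v) [Monoid M] : Prop :=
  ∀ a : M, ∃ n : ℕ, 1 ≤ n ∧ IsIdempotentElem (a ^ n) ∧ a ^ n = a ^ n * a

/-- The language `L ⊆ A*` is recognised by the monoid `M`: membership in `L` is the inverse image
of an accepting subset of `M` under some monoid homomorphism `A* → M`. -/
def RecognisedBy {A : Type u} (L : Language A) (M : Type v) [Monoid M] : Prop :=
  ∃ (h : FreeMonoid A →* M) (F : Set M), ∀ w : List A, w ∈ L ↔ h (FreeMonoid.ofList w) ∈ F

def RecognisedByFiniteAperiodicMonoid {A : Type u} (L : Language A) : Prop :=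
  ∃ (M : Type v) (_ : Monoid M), Finite M ∧ IsAperiodic M ∧ RecognisedBy L M

/-! ### Star-free expressions -/

inductive StarFreeExpr (A : Type u) : Type u
  | letter (a : A) : StarFreeExpr A
  | empty : StarFreeExpr A
  | concat (e f : StarFreeExpr A) : StarFreeExpr A
  | union (e f : StarFreeExpr A) : StarFreeExpr A
  | compl (e : StarFreeExpr A) : StarFreeExpr A

/-- The language described by a star-free expression. In `Language A`, `0` is the empty language,
`*` is concatenation and `+` is union; complements are taken with respect to `A*`. -/
def StarFreeExpr.lang {A : Type u} : StarFreeExpr A → Language A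
  | .letter a => {[a]}
  | .empty => 0
  | .concat e f => e.lang * f.lang
  | .union e f => e.lang + f.lang
  | .compl e => {w : List A | w ∉ e.lang}

def IsStarFree {A : Type u} (L : Language A) : Prop :=
  ∃ e : StarFreeExpr A, e.lang = L

/-! ### First-order logic over the ordered model -/

/-- Relation names of the ordered model, indexed by arity: the order `x ≤ y` and, for each letter
`a`, the label predicate `a(x)`. -/
inductive WordRel (A : Type u) : ℕ → Type u
  | le : WordRel A 2
  | label (a : A) : WordRel A 1

/-- The (purely relational) vocabulary of the ordered model. -/
def wordVocabulary (A : Type u) : FirstOrder.Language.{0, u} where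
  Functions := fun _ => Empty
  Relations := WordRel A

/-- The ordered model of a word `w`: its universe is the set of positions of `w`, which is empty
for the empty word. -/
@[reducible]
def orderedModel {A : Type u} (w : List A) : (wordVocabulary A).Structure (Fin w.length) where
  funMap := fun f => Empty.elim f
  RelMap := fun R xs =>
    match R, xs with
    | .le, xs => xs 0 ≤ xs 1
    | .label a, xs => w.get (xs 0) = a

def IsFODefinable {A : Type u} (L : Language A) : Prop :=
  ∃ φ : (wordVocabulary A).Sentence, ∀ w : List A,
    w ∈ L ↔ @FirstOrder.Language.Sentence.Realize (wordVocabulary A) (Fin w.length)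
      (orderedModel w) φ

/-! ### Linear temporal logic with strict until -/

inductive LTLFormula (A : Type u) : Type u
  | letter (a : A) : LTLFormula A
  | and (φ ψ : LTLFormula A) : LTLFormula A
  | or (φ ψ : LTLFormula A) : LTLFormula A
  | not (φ : LTLFormula A) : LTLFormula A
  | until (φ ψ : LTLFormula A) : LTLFormula A

/-- `φ.Holds w x` means that `φ` is true at the position `x` of the word `w`. -/
def LTLFormula.Holds {A : Type u} (w : List A) : LTLFormula A → Fin w.length → Prop
  | .letter a, x => w.get x = a
  | .and φ ψ, x => φ.Holds w x ∧ ψ.Holds w x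
  | .or φ ψ, x => φ.Holds w x ∨ ψ.Holds w x
  | .not φ, x => ¬ φ.Holds w x
  | .until φ ψ, x =>
      ∃ y : Fin w.length, x < y ∧ ψ.Holds w y ∧ ∀ z : Fin w.length, x < z → z < y → φ.Holds w z

/-- Some formula is true in the first position of exactly those nonempty words that belong to `L`;
the empty word is not taken into account. -/
def IsLTLDefinable {A : Type u} (L : Language A) : Prop :=
  ∃ φ : LTLFormula A, ∀ (w : List A) (hw : w ≠ []),
    w ∈ L ↔ φ.Holds w ⟨0, List.length_pos_iff.mpr hw⟩

end WordLogic

namespace WordLogic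


/-! The five implications are 1 → 2, 1 → 4, 4 → 3, 2 → 1 and 3 → 1.

From monoids to formalisms, one induction serves both star-free expressions and temporal logic. Let
a finite set `Q` carry an aperiodic action and let `c` be a letter acting nontrivially. Cut each
word at its occurrences of `c`. Within a block `c` does not occur, so fewer letters act
nontrivially. Each inner block, followed by `c`, acts on the range of `c`, which is smaller than `Q`
because a surjective map with stabilising powers is the identity
(`IsAperiodicAction.eq_id_of_surjective`). The word of inner blocks is thus a word over a new finite
alphabet acting on a smaller set. `BlockClosed` lists the closure properties this uses,
`BlockClosed.action` is the induction, and the two instances are `blockClosed_isStarFreePred` and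
`blockClosed_isLTLPred`.

Back to monoids, concatenation and first-order quantification both ask for a factorisation of a word
around a letter. `LetterProduct` records the images of all such factorisations and stays finite and
aperiodic. For formulas, the values of the variables are written into the letters (`markedWord`).
Temporal logic translates directly into first-order logic. -/

/-! ### Cutting a word at the occurrences of a letter -/

open Classical in
/-- The part of a word before the first occurrence of `c` (the whole word if there is none). -/
noncomputable def firstBlock {A : Type u} (c : A) : List A → List A
  | [] => []
  | a :: s => if a = c then [] else a :: firstBlock c s

open Classical in
/-- The part of a word after the last occurrence of `c` (the whole word if there is none). -/
noncomputable def lastBlock {A : Type u} (c : A) : List A → List A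
  | [] => []
  | a :: s => if c ∈ s then lastBlock c s else if a = c then s else a :: s

open Classical in
/-- The word of `β`-values of the blocks strictly between consecutive occurrences of `c`. -/
noncomputable def middleBlocks {A T : Type u} (c : A) (β : List A → T) : List A → List T
  | [] => []
  | a :: s => if a = c ∧ c ∈ s then β (firstBlock c s) :: middleBlocks c β s
      else middleBlocks c β s

section Blocks

variable {A T : Type u} {c : A} {β : List A → T}

lemma firstBlock_cons_self (s : List A) : firstBlock c (c :: s) = [] := by simp [firstBlock]

lemma firstBlock_cons_of_ne {a : A} (h : a ≠ c) (s : List A) :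
    firstBlock c (a :: s) = a :: firstBlock c s := by simp [firstBlock, h]

lemma firstBlock_of_notMem {s : List A} (h : c ∉ s) : firstBlock c s = s := by
  induction s with
  | nil => rfl
  | cons a s ih =>
    simp only [List.mem_cons, not_or] at h
    rw [firstBlock_cons_of_ne (Ne.symm h.1), ih h.2]

lemma firstBlock_append_cons {u : List A} (h : c ∉ u) (s : List A) :
    firstBlock c (u ++ c :: s) = u := by
  induction u with
  | nil => exact firstBlock_cons_self s
  | cons a u ih =>
    simp only [List.mem_cons, not_or] at h
    rw [List.cons_append, firstBlock_cons_of_ne (Ne.symm h.1), ih h.2]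

/-- A word containing `c` splits at the first occurrence of `c`. -/
lemma exists_eq_append_cons_of_mem {s : List A} (h : c ∈ s) :
    ∃ u t, c ∉ u ∧ s = u ++ c :: t := by
  induction s with
  | nil => simp at h
  | cons a s ih =>
    by_cases ha : a = c
    · exact ⟨[], s, by simp, by simp [ha]⟩
    · obtain ⟨u, t, hu, rfl⟩ := ih (by simpa [Ne.symm ha] using h)
      exact ⟨a :: u, t, by simp [hu, Ne.symm ha], rfl⟩

lemma lastBlock_of_notMem {s : List A} (h : c ∉ s) : lastBlock c s = s := by
  cases s with
  | nil => rfl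
  | cons a s =>
    simp only [List.mem_cons, not_or] at h
    simp [lastBlock, h.2, Ne.symm h.1]

lemma lastBlock_append_cons (u : List A) {s : List A} (h : c ∉ s) :
    lastBlock c (u ++ c :: s) = s := by
  induction u with
  | nil => simp [lastBlock, h]
  | cons a u ih => simp [lastBlock, ih]

lemma lastBlock_cons_of_mem (a : A) {s : List A} (h : c ∈ s) :
    lastBlock c (a :: s) = lastBlock c s := by
  simp [lastBlock, h]

lemma notMem_lastBlock (s : List A) : c ∉ lastBlock c s := by
  induction s with
  | nil => simp [lastBlock]
  | cons a s ih =>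
    by_cases h : c ∈ s
    · rwa [lastBlock_cons_of_mem a h]
    · by_cases ha : a = c
      · simp [lastBlock, h, ha]
      · simp [lastBlock, h, ha, Ne.symm ha]

/-- A word containing `c` splits at the last occurrence of `c`. -/
lemma exists_eq_append_cons_lastBlock {s : List A} (h : c ∈ s) :
    ∃ u, s = u ++ c :: lastBlock c s := by
  induction s with
  | nil => simp at h
  | cons a s ih =>
    by_cases hs : c ∈ s
    · obtain ⟨u, hu⟩ := ih hs
      exact ⟨a :: u, by rw [lastBlock_cons_of_mem a hs, List.cons_append, ← hu]⟩
    · obtain rfl : c = a := by simpa [hs] using h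
      exact ⟨[], by simp [lastBlock, hs]⟩

lemma middleBlocks_cons_of_ne {a : A} (h : a ≠ c) (s : List A) :
    middleBlocks c β (a :: s) = middleBlocks c β s := by
  simp [middleBlocks, h]

lemma middleBlocks_cons_self_of_mem {s : List A} (h : c ∈ s) :
    middleBlocks c β (c :: s) = β (firstBlock c s) :: middleBlocks c β s := by
  simp [middleBlocks, h]

lemma middleBlocks_of_notMem {s : List A} (h : c ∉ s) : middleBlocks c β s = [] := by
  induction s with
  | nil => rfl
  | cons a s ih =>
    simp only [List.mem_cons, not_or] at h
    rw [middleBlocks_cons_of_ne (Ne.symm h.1), ih h.2]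

lemma middleBlocks_cons_of_notMem (a : A) {s : List A} (h : c ∉ s) :
    middleBlocks c β (a :: s) = [] := by
  simp [middleBlocks, h, middleBlocks_of_notMem h]

lemma middleBlocks_append {u : List A} (h : c ∉ u) (s : List A) :
    middleBlocks c β (u ++ s) = middleBlocks c β s := by
  induction u with
  | nil => rfl
  | cons a u ih =>
    simp only [List.mem_cons, not_or] at h
    rw [List.cons_append, middleBlocks_cons_of_ne (Ne.symm h.1), ih h.2]

lemma middleBlocks_cons_append_cons {u : List A} (h : c ∉ u) (s : List A) :
    middleBlocks c β (c :: (u ++ c :: s)) = β u :: middleBlocks c β (c :: s) := by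
  rw [middleBlocks_cons_self_of_mem (by simp), firstBlock_append_cons h, middleBlocks_append h]

end Blocks

/-! ### Block-closed classes of languages -/

/-- Closure properties of a class of languages (given as predicates on words, for every alphabet)
that suffice for it to contain all languages recognised by finite aperiodic monoids. -/
structure BlockClosed (C : ∀ A : Type u, (List A → Prop) → Prop) : Prop where
  not : ∀ {A : Type u} [Nonempty A] {P : List A → Prop}, C A P → C A (fun w => ¬ P w)
  or : ∀ {A : Type u} [Nonempty A] {P Q : List A → Prop}, C A P → C A Q →
    C A (fun w => P w ∨ Q w)
  mem : ∀ {A : Type u} [Nonempty A] (c : A), C A (fun w => c ∈ w)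
  first : ∀ {A : Type u} [Nonempty A] (c : A) {P : List A → Prop}, C A P →
    C A (fun w => P (firstBlock c w))
  last : ∀ {A : Type u} [Nonempty A] (c : A) {P : List A → Prop}, C A P →
    C A (fun w => P (lastBlock c w))
  middle : ∀ {A T : Type u} [Finite A] [Nonempty A] [Nonempty T] (c : A) (β : List A → T)
    {P : List T → Prop}, (∀ t, C A (fun w => β w = t)) → C T P →
    C A (fun w => P (middleBlocks c β w))

namespace BlockClosed

variable {C : ∀ A : Type u, (List A → Prop) → Prop} {A : Type u} [Nonempty A]

lemma and (hC : BlockClosed C) {P Q : List A → Prop} (hP : C A P) (hQ : C A Q) :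
    C A (fun w => P w ∧ Q w) := by
  have := hC.not (hC.or (hC.not hP) (hC.not hQ))
  simpa only [not_or, not_not] using this

lemma const (hC : BlockClosed C) (p : Prop) : C A (fun _ => p) := by
  -- Any letter will do: constants arise as a tautology or a contradiction about its occurrence.
  have hm := hC.mem (Classical.arbitrary A)
  by_cases hp : p
  · simpa [hp, em] using hC.or hm (hC.not hm)
  · simpa [hp] using hC.and hm (hC.not hm)

lemma exists_finite (hC : BlockClosed C) {ι : Type*} [Finite ι] {P : ι → List A → Prop}
    (h : ∀ i, C A (P i)) : C A (fun w => ∃ i, P i w) := by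
  classical
  have key : ∀ s : Finset ι, C A (fun w => ∃ i ∈ s, P i w) := by
    intro s
    induction s using Finset.induction_on with
    | empty => simpa using hC.const False
    | insert a s _ ih => simpa using hC.or (h a) ih
  have := Fintype.ofFinite ι
  simpa using key Finset.univ

lemma forall_finite (hC : BlockClosed C) {ι : Type*} [Finite ι] {P : ι → List A → Prop}
    (h : ∀ i, C A (P i)) : C A (fun w => ∀ i, P i w) := by
  have := hC.not (hC.exists_finite fun i => hC.not (h i))
  simpa only [not_exists, not_not] using this

/-- If every fibre of an invariant with finitely many values is in the class, then so is every
language that depends only on this invariant. -/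
lemma of_fibres (hC : BlockClosed C) {R : Type*} [Finite R] {ρ : List A → R}
    (h : ∀ t, C A (fun w => ρ w = t)) (S : R → Prop) : C A (fun w => S (ρ w)) := by
  have := hC.exists_finite fun t => hC.and (h t) (hC.const (S t))
  simpa using this

end BlockClosed

/-! ### The induction on finite aperiodic actions -/

/-- The maps by which the words act on `Q` (through the generators `f`) have stabilising powers. -/
def IsAperiodicAction {A : Type u} {Q : Type v} (f : A → Q → Q) : Prop :=
  ∀ w : List A, ∃ n : ℕ, ∀ q, (fun q => w.foldr f q)^[n + 1] q = (fun q => w.foldr f q)^[n] q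

/-- Iterates commute with `e`, so the exponent that stabilises `w` on `Q` also stabilises `x` on
`R`. It serves both for neutralising a letter and for passing to the range of a letter. -/
lemma IsAperiodicAction.of_embedding {A B : Type u} {Q R : Type v} {f : A → Q → Q}
    {g : B → R → R} (hf : IsAperiodicAction f) (e : R → Q) (he : Function.Injective e)
    (h : ∀ x : List B, ∃ w : List A, ∀ r, e (x.foldr g r) = w.foldr f (e r)) :
    IsAperiodicAction g := by
  intro x
  obtain ⟨w, hw⟩ := h x
  obtain ⟨n, hn⟩ := hf w
  have key : ∀ k r, e ((fun r => x.foldr g r)^[k] r) = (fun q => w.foldr f q)^[k] (e r) :=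
    fun k => Function.Semiconj.iterate_right (f := e) (ga := fun r => x.foldr g r)
      (gb := fun q => w.foldr f q) hw k
  exact ⟨n, fun r => he (by rw [key, key, hn])⟩

/-- Every point is an `n`-th iterate of some point, and `f c` fixes `n`-th iterates. This is where
aperiodicity makes the induction descend: permutations other than the identity are excluded. -/
lemma IsAperiodicAction.eq_id_of_surjective {A : Type u} {Q : Type v} {f : A → Q → Q}
    (hf : IsAperiodicAction f) {c : A} (hc : Function.Surjective (f c)) : f c = id := by
  obtain ⟨n, hn⟩ := hf [c]
  funext q
  obtain ⟨q, rfl⟩ := hc.iterate n q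
  have := hn q
  rw [Function.iterate_succ_apply'] at this
  exact this

lemma foldr_congr_of_notMem {A : Type u} {Q : Type v} {f f' : A → Q → Q} {c : A}
    (hf : ∀ a, a ≠ c → f' a = f a) {w : List A} (hw : c ∉ w) (q : Q) :
    w.foldr f' q = w.foldr f q := by
  induction w with
  | nil => rfl
  | cons a s ih =>
    simp only [List.mem_cons, not_or] at hw
    rw [List.foldr_cons, List.foldr_cons, ih hw.2, hf a (Ne.symm hw.1)]

/-- The action of a word containing `c`, computed from its blocks: the blocks between two
occurrences of `c`, followed on the left by `c`, act on the range of `f c`. -/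
lemma foldr_eq_blocks {A T : Type u} {Q : Type v} {f f' : A → Q → Q} {c : A} {β : List A → T}
    {g : T → Set.range (f c) → Set.range (f c)} (hf : ∀ a, a ≠ c → f' a = f a)
    (hg : ∀ v x, (g (β v) x : Q) = f c (v.foldr f' x)) (q : Q) {w : List A} (hw : c ∈ w) :
    w.foldr f q = (firstBlock c w).foldr f'
      ((middleBlocks c β w).foldr g ⟨f c ((lastBlock c w).foldr f' q), Set.mem_range_self _⟩ :
        Set.range (f c)) := by
  induction w with
  | nil => simp at hw
  | cons a s ih =>
    by_cases ha : a = c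
    · subst ha
      by_cases hs : a ∈ s
      · rw [firstBlock_cons_self, middleBlocks_cons_self_of_mem hs, lastBlock_cons_of_mem a hs,
          List.foldr_cons, List.foldr_nil, List.foldr_cons, hg, ← ih hs]
      · rw [firstBlock_cons_self, middleBlocks_cons_of_notMem a hs,
          show lastBlock a (a :: s) = s from lastBlock_append_cons [] hs, List.foldr_cons,
          List.foldr_nil, List.foldr_nil, foldr_congr_of_notMem hf hs]
    · have hs : c ∈ s := by simpa [Ne.symm ha] using hw
      rw [firstBlock_cons_of_ne ha, middleBlocks_cons_of_ne ha, lastBlock_cons_of_mem a hs,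
        List.foldr_cons, List.foldr_cons, ← ih hs, hf a ha]

/-- A block-closed class contains all languages recognised by a finite aperiodic action. -/
theorem BlockClosed.action {C : ∀ A : Type u, (List A → Prop) → Prop} (hC : BlockClosed C)
    (n : ℕ) {A : Type u} [Finite A] [Nonempty A] {Q : Type u} [Finite Q] (hn : Nat.card Q = n)
    (f : A → Q → Q) (hf : IsAperiodicAction f) (q₀ q : Q) :
    C A (fun w => w.foldr f q₀ = q) := by
  classical
  -- Lexicographic induction: first the size of `Q`, with the alphabet free to change, then the
  -- number of letters that do not act as the identity.
  induction n using Nat.strong_induction_on generalizing A Q with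
  | _ n ihQ =>
  induction hk : {a | f a ≠ id}.ncard using Nat.strong_induction_on generalizing f q₀ q with
  | _ k ihA =>
  by_cases htriv : ∀ a, f a = id
  · have : ∀ w : List A, w.foldr f q₀ = q₀ := by
      intro w
      induction w with
      | nil => rfl
      | cons a s ih => rw [List.foldr_cons, ih, htriv a]; rfl
    simpa only [this] using hC.const (q₀ = q)
  push Not at htriv
  obtain ⟨c, hc⟩ := htriv
  -- Instead of removing `c` from the alphabet, let it act trivially; on blocks without `c` nothing
  -- changes.
  set f' : A → Q → Q := Function.update f c id with hf'_def
  have hf'c : f' c = id := by simp [hf'_def]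
  have hf'_ne : ∀ a, a ≠ c → f' a = f a := fun a ha => by simp [hf'_def, ha]
  have erase : ∀ v : List A, ∃ w : List A, ∀ q, v.foldr f' q = w.foldr f q := by
    intro v
    induction v with
    | nil => exact ⟨[], fun _ => rfl⟩
    | cons a v ih =>
      obtain ⟨w, hw⟩ := ih
      by_cases ha : a = c
      · exact ⟨w, fun q => by rw [List.foldr_cons, ha, hf'c, ← hw]; rfl⟩
      · exact ⟨a :: w, fun q => by rw [List.foldr_cons, List.foldr_cons, hf'_ne a ha, hw]⟩
  have hf' : IsAperiodicAction f' := hf.of_embedding id Function.injective_id erase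
  have hcard' : {a | f' a ≠ id}.ncard < k := by
    rw [← hk]
    apply Set.ncard_lt_ncard _ (Set.toFinite _)
    refine ⟨fun a ha => ?_, fun h => h (show c ∈ {a | f a ≠ id} from hc) hf'c⟩
    by_cases hac : a = c
    · rw [hac]; exact hc
    · simpa [hf'_ne a hac] using ha
  have act' : ∀ q₁ q₂, C A (fun w => w.foldr f' q₁ = q₂) :=
    fun q₁ q₂ => ihA _ hcard' f' hf' q₁ q₂ rfl
  -- Since `foldr` lets the rightmost letter act first, a block is followed by the `c` on its left.
  -- The new alphabet is the range of `act`, not all self-maps, so that each new letter comes from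
  -- an actual word; aperiodicity of `g` needs this.
  let act : List A → Set.range (f c) → Set.range (f c) :=
    fun v x => ⟨f c (v.foldr f' x), Set.mem_range_self _⟩
  let β : List A → Set.range act := Set.rangeFactorization act
  let g : Set.range act → Set.range (f c) → Set.range (f c) := fun t => t
  have hlt : Nat.card (Set.range (f c)) < n := by
    rw [← hn, Nat.card_coe_set_eq, ← Set.ncard_univ]
    apply Set.ncard_lt_ncard _ (Set.toFinite _)
    rw [Set.ssubset_univ_iff, Ne, Set.range_eq_univ]
    exact fun hs => hc (hf.eq_id_of_surjective hs)
  have hg : IsAperiodicAction g := by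
    refine hf.of_embedding Subtype.val Subtype.val_injective fun x => ?_
    induction x with
    | nil => exact ⟨[], fun _ => rfl⟩
    | cons t x ih =>
      obtain ⟨w, hw⟩ := ih
      obtain ⟨_, v, rfl⟩ := t
      obtain ⟨w', hw'⟩ := erase v
      refine ⟨c :: (w' ++ w), fun r => ?_⟩
      rw [List.foldr_cons, List.foldr_cons, List.foldr_append, ← hw, ← hw']
  have hβ : ∀ t, C A (fun v => β v = t) := by
    -- Equality of two self-maps of a finite set is a finite conjunction of conditions on the action
    -- of `f'`.
    intro t
    have := hC.forall_finite fun x : Set.range (f c) => hC.of_fibres (act' x)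
      (fun y => f c y = (t : Set.range (f c) → Set.range (f c)) x)
    refine iff_of_eq (congrArg (C A) (funext fun v => propext ?_)) |>.mp this
    rw [Subtype.ext_iff, funext_iff]
    simp only [Subtype.ext_iff]
    rfl
  have : Nonempty (Set.range act) := ⟨β []⟩
  have hmid : ∀ x y, C A (fun w => (middleBlocks c β w).foldr g x = y) := fun x y =>
    hC.middle c β hβ (ihQ _ hlt rfl g hg x y)
  -- Finite disjunction over the states `x` and `y` reached after the last block and after the
  -- middle blocks.
  have hcont : C A (fun w => ∃ x y, (lastBlock c w).foldr f' q₀ = x ∧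
      (middleBlocks c β w).foldr g ⟨f c x, Set.mem_range_self _⟩ = y ∧
      (firstBlock c w).foldr f' y = q) :=
    hC.exists_finite fun x => hC.exists_finite fun y =>
      hC.and (hC.last c (act' q₀ x)) (hC.and (hmid _ y) (hC.first c (act' y q)))
  have := hC.or (hC.and (hC.not (hC.mem c)) (act' q₀ q)) (hC.and (hC.mem c) hcont)
  refine iff_of_eq (congrArg (C A) (funext fun w => propext ?_)) |>.mp this
  by_cases hw : c ∈ w
  · rw [foldr_eq_blocks (β := β) (g := g) hf'_ne (fun _ _ => rfl) q₀ hw]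
    simp [hw]
  · simp [hw, foldr_congr_of_notMem hf'_ne hw]

/-- A block-closed class contains all languages recognised by a finite aperiodic monoid. -/
theorem BlockClosed.of_recognised {C : ∀ A : Type u, (List A → Prop) → Prop}
    (hC : BlockClosed C) {A : Type u} [Finite A] [Nonempty A] {L : Language A}
    (hL : RecognisedByFiniteAperiodicMonoid.{u, v} L) : C A (fun w => w ∈ L) := by
  obtain ⟨M, _, _, hM, h, F, hF⟩ := hL
  -- The monoid acts on itself by left multiplication; being finite, it has a copy in the universe
  -- of the alphabet.
  let e : Shrink.{u} M ≃ M := (equivShrink.{u} M).symm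
  let f : A → Shrink.{u} M → Shrink.{u} M := fun a m => e.symm (h (FreeMonoid.of a) * e m)
  have hact : ∀ (w : List A) m, e (w.foldr f m) = h (FreeMonoid.ofList w) * e m := by
    intro w m
    induction w with
    | nil => simp
    | cons a w ih => simp [f, ih, FreeMonoid.ofList_cons, mul_assoc]
  have hf : IsAperiodicAction f := by
    intro w
    obtain ⟨n, -, -, hn⟩ := hM (h (FreeMonoid.ofList w))
    have key : ∀ k m, e ((fun m => w.foldr f m)^[k] m) = h (FreeMonoid.ofList w) ^ k * e m := by
      intro k m
      induction k with
      | zero => simp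
      | succ k ih => rw [Function.iterate_succ_apply', hact, ih, pow_succ', mul_assoc]
    exact ⟨n, fun m => e.injective (by rw [key, key, pow_succ, ← hn])⟩
  have := hC.of_fibres (ρ := fun w => w.foldr f (e.symm 1))
    (fun q => hC.action _ rfl f hf (e.symm 1) q) (fun m => e m ∈ F)
  simpa [hact, hF] using this


/-! ### Star-free languages are block-closed -/

/-- The predicate `P` on words describes a star-free language. -/
def IsStarFreePred (A : Type u) (P : List A → Prop) : Prop :=
  ∃ e : StarFreeExpr A, ∀ w, w ∈ e.lang ↔ P w

namespace IsStarFreePred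

variable {A : Type u} {P Q : List A → Prop}

lemma congr (hP : IsStarFreePred A P) (h : ∀ w, P w ↔ Q w) : IsStarFreePred A Q := by
  obtain ⟨e, he⟩ := hP
  exact ⟨e, fun w => (he w).trans (h w)⟩

lemma letter (a : A) : IsStarFreePred A (fun w => w = [a]) := ⟨.letter a, fun _ => Iff.rfl⟩

lemma not (hP : IsStarFreePred A P) : IsStarFreePred A (fun w => ¬ P w) := by
  obtain ⟨e, he⟩ := hP
  exact ⟨.compl e, fun w => not_congr (he w)⟩

lemma or (hP : IsStarFreePred A P) (hQ : IsStarFreePred A Q) :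
    IsStarFreePred A (fun w => P w ∨ Q w) := by
  obtain ⟨e, he⟩ := hP
  obtain ⟨f, hf⟩ := hQ
  exact ⟨.union e f, fun w => or_congr (he w) (hf w)⟩

lemma and (hP : IsStarFreePred A P) (hQ : IsStarFreePred A Q) :
    IsStarFreePred A (fun w => P w ∧ Q w) :=
  (hP.not.or hQ.not).not.congr fun w => by simp only [not_or, not_not]

lemma const (p : Prop) : IsStarFreePred A (fun _ => p) := by
  by_cases hp : p
  · exact ⟨.compl .empty, fun w => iff_of_true (fun h => h) hp⟩
  · exact ⟨.empty, fun w => iff_of_false (fun h => h) hp⟩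

lemma concat (hP : IsStarFreePred A P) (hQ : IsStarFreePred A Q) :
    IsStarFreePred A (fun w => ∃ x y, P x ∧ Q y ∧ x ++ y = w) := by
  obtain ⟨e, he⟩ := hP
  obtain ⟨f, hf⟩ := hQ
  refine ⟨.concat e f, fun w => ?_⟩
  simp only [StarFreeExpr.lang, Language.mem_mul, he, hf]
  constructor
  · rintro ⟨x, hx, y, hy, h⟩
    exact ⟨x, y, hx, hy, h⟩
  · rintro ⟨x, y, hx, hy, h⟩
    exact ⟨x, hx, y, hy, h⟩

lemma concat_cons (hP : IsStarFreePred A P) (c : A) (hQ : IsStarFreePred A Q) :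
    IsStarFreePred A (fun w => ∃ x y, P x ∧ Q y ∧ x ++ c :: y = w) := by
  refine (hP.concat ((letter c).concat hQ)).congr fun w => ?_
  constructor
  · rintro ⟨x, _, hx, ⟨_, y, rfl, hy, rfl⟩, h⟩
    exact ⟨x, y, hx, hy, h⟩
  · rintro ⟨x, y, hx, hy, h⟩
    exact ⟨x, c :: y, hx, ⟨[c], y, rfl, hy, rfl⟩, h⟩

lemma mem (c : A) : IsStarFreePred A (fun w => c ∈ w) := by
  refine ((const True).concat_cons c (const True)).congr fun w => ?_
  rw [List.mem_iff_append]
  simp [eq_comm]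

lemma eq_nil [Finite A] : IsStarFreePred A (fun w => w = []) := by
  classical
  have key : ∀ s : Finset A, IsStarFreePred A (fun w => ∀ a ∈ s, a ∉ w) := by
    intro s
    induction s using Finset.induction_on with
    | empty => exact (const True).congr fun w => by simp
    | insert a s _ ih => exact ((mem a).not.and ih).congr fun w => by simp
  have := Fintype.ofFinite A
  exact (key Finset.univ).congr fun w => by simp [List.eq_nil_iff_forall_not_mem]

end IsStarFreePred

/-- Words that are empty or end with the letter `c`, read block by block. -/
inductive TerminatedBy {A : Type u} (c : A) : List A → Prop
  | nil : TerminatedBy c []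
  | block {u x : List A} (hu : c ∉ u) (hx : TerminatedBy c x) : TerminatedBy c (u ++ c :: x)

section TerminatedBy

variable {A T : Type u} {c : A} {β : List A → T}

lemma TerminatedBy.append {x y : List A} (hx : TerminatedBy c x) (hy : TerminatedBy c y) :
    TerminatedBy c (x ++ y) := by
  induction hx with
  | nil => exact hy
  | block hu _ ih =>
    rw [List.append_assoc]
    exact .block hu ih

lemma terminatedBy_append_singleton (c : A) (y : List A) : TerminatedBy c (y ++ [c]) := by
  induction h : y.length using Nat.strong_induction_on generalizing y with
  | _ n ih =>
  by_cases hc : c ∈ y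
  · obtain ⟨u, t, hu, rfl⟩ := exists_eq_append_cons_of_mem hc
    rw [List.append_assoc]
    exact .block hu (ih t.length (by rw [← h]; simp; omega) t rfl)
  · exact .block hc .nil

lemma terminatedBy_iff {x : List A} : TerminatedBy c x ↔ x = [] ∨ ∃ y, x = y ++ [c] := by
  constructor
  · intro h
    induction h with
    | nil => exact .inl rfl
    | @block u x hu _ ih =>
      rcases ih with rfl | ⟨y, rfl⟩
      · exact .inr ⟨u, rfl⟩
      · exact .inr ⟨u ++ c :: y, by simp⟩
  · rintro (rfl | ⟨y, rfl⟩)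
    · exact .nil
    · exact terminatedBy_append_singleton c y

lemma exists_eq_terminatedBy_append (s : List A) :
    ∃ x y, TerminatedBy c x ∧ c ∉ y ∧ x ++ y = s := by
  by_cases hs : c ∈ s
  · obtain ⟨u, hu⟩ := exists_eq_append_cons_lastBlock hs
    exact ⟨u ++ [c], lastBlock c s, terminatedBy_append_singleton c u, notMem_lastBlock s,
      by simpa using hu.symm⟩
  · exact ⟨[], s, .nil, hs, rfl⟩

/-- The final `c` of `x`, or the prepended one if `x` is empty, opens the first block of `y`. So on
terminated words `x ↦ middleBlocks c β (c :: x)` is multiplicative. -/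
lemma TerminatedBy.middleBlocks_append {x : List A} (hx : TerminatedBy c x) (y : List A) :
    middleBlocks c β (c :: (x ++ y)) = middleBlocks c β (c :: x) ++ middleBlocks c β (c :: y) := by
  induction hx with
  | nil => simp [middleBlocks_cons_of_notMem (s := []) c]
  | block hu _ ih =>
    rw [List.append_assoc, List.cons_append, middleBlocks_cons_append_cons hu,
      middleBlocks_cons_append_cons hu, ih, List.cons_append]

/-- Cutting between blocks lifts factorisations of the block word, which is what concatenation over
`T` needs. -/
lemma TerminatedBy.exists_split {x : List A} (hx : TerminatedBy c x) {k l : List T}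
    (h : middleBlocks c β (c :: x) = k ++ l) :
    ∃ y z, TerminatedBy c y ∧ TerminatedBy c z ∧ middleBlocks c β (c :: y) = k ∧
      middleBlocks c β (c :: z) = l ∧ y ++ z = x := by
  induction hx generalizing k with
  | nil =>
    have hnil : middleBlocks c β [c] = [] := middleBlocks_cons_of_notMem c (by simp)
    rw [hnil, eq_comm, List.append_eq_nil_iff] at h
    exact ⟨[], [], .nil, .nil, hnil.trans h.1.symm, hnil.trans h.2.symm, rfl⟩
  | @block u x hu hx ih =>
    cases k with
    | nil =>
      exact ⟨[], u ++ c :: x, .nil, .block hu hx, middleBlocks_cons_of_notMem c (by simp), h, rfl⟩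
    | cons t k =>
      rw [middleBlocks_cons_append_cons hu, List.cons_append, List.cons.injEq] at h
      obtain ⟨y, z, hy, hz, rfl, rfl, rfl⟩ := ih h.2
      exact ⟨u ++ c :: y, z, .block hu hy, hz, by rw [middleBlocks_cons_append_cons hu, h.1], rfl,
        by simp⟩

lemma TerminatedBy.middleBlocks_eq_singleton_iff {x : List A} {t : T} :
    TerminatedBy c x ∧ middleBlocks c β (c :: x) = [t] ↔ ∃ u, c ∉ u ∧ β u = t ∧ u ++ [c] = x := by
  constructor
  · rintro ⟨hx, h⟩
    cases hx with
    | nil => simp [middleBlocks_cons_of_notMem (s := []) c] at h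
    | @block u x hu hx =>
      rw [middleBlocks_cons_append_cons hu, List.cons.injEq] at h
      cases hx with
      | nil => exact ⟨u, hu, h.1, rfl⟩
      | block hv hx => simp [middleBlocks_cons_append_cons hv] at h
  · rintro ⟨u, hu, rfl, rfl⟩
    refine ⟨.block hu .nil, ?_⟩
    rw [middleBlocks_cons_append_cons hu, middleBlocks_cons_of_notMem c (by simp)]

end TerminatedBy

namespace IsStarFreePred

variable {A T : Type u}

lemma terminatedBy [Finite A] (c : A) : IsStarFreePred A (TerminatedBy c) := by
  refine (eq_nil.or ((const True).concat_cons c eq_nil)).congr fun w => ?_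
  rw [terminatedBy_iff]
  simp [eq_comm]

/-- Substitution into the expression: a letter `t` becomes the `c`-free words of value `t` followed
by `c`, and complements are taken within the terminated words. -/
lemma terminatedBy_and_lang [Finite A] (c : A) {β : List A → T}
    (hβ : ∀ t, IsStarFreePred A (fun w => β w = t)) (e : StarFreeExpr T) :
    IsStarFreePred A (fun x => TerminatedBy c x ∧ middleBlocks c β (c :: x) ∈ e.lang) := by
  induction e with
  | letter t =>
    refine (((mem c).not.and (hβ t)).concat (letter c)).congr fun w => ?_
    refine Iff.trans ?_ TerminatedBy.middleBlocks_eq_singleton_iff.symm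
    constructor
    · rintro ⟨u, _, ⟨hu, ht⟩, rfl, h⟩
      exact ⟨u, hu, ht, h⟩
    · rintro ⟨u, hu, ht, h⟩
      exact ⟨u, [c], ⟨hu, ht⟩, rfl, h⟩
  | empty => exact (const False).congr fun w => iff_of_false id fun h => h.2
  | concat e f ihe ihf =>
    refine (ihe.concat ihf).congr fun w => ?_
    simp only [StarFreeExpr.lang, Language.mem_mul]
    constructor
    · rintro ⟨x, y, ⟨hx, hxe⟩, ⟨hy, hyf⟩, rfl⟩
      exact ⟨hx.append hy, _, hxe, _, hyf, (hx.middleBlocks_append y).symm⟩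
    · rintro ⟨hw, k, hk, l, hl, h⟩
      obtain ⟨y, z, hy, hz, rfl, rfl, hyz⟩ := hw.exists_split h.symm
      exact ⟨y, z, ⟨hy, hk⟩, ⟨hz, hl⟩, hyz⟩
  | union e f ihe ihf =>
    refine (ihe.or ihf).congr fun w => ?_
    rw [← and_or_left]
    rfl
  | compl e ih =>
    refine ((terminatedBy c).and ih.not).congr fun w => ?_
    rw [and_congr_right_iff]
    intro hw
    simp only [hw, true_and]
    rfl

end IsStarFreePred

theorem blockClosed_isStarFreePred : BlockClosed.{u} IsStarFreePred where
  not := IsStarFreePred.not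
  or := IsStarFreePred.or
  mem := IsStarFreePred.mem
  first c P hP := by
    -- Forbidding `c` in the prefix forces the cut to be at the first occurrence.
    have hn := (IsStarFreePred.mem c).not.and hP
    refine (hn.or (hn.concat_cons c (.const True))).congr fun w => ?_
    constructor
    · rintro (⟨hw, h⟩ | ⟨x, y, ⟨hx, h⟩, -, rfl⟩)
      · rwa [firstBlock_of_notMem hw]
      · rwa [firstBlock_append_cons hx]
    · intro h
      by_cases hw : c ∈ w
      · obtain ⟨u, t, hu, rfl⟩ := exists_eq_append_cons_of_mem hw
        rw [firstBlock_append_cons hu] at h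
        exact .inr ⟨u, t, ⟨hu, h⟩, trivial, rfl⟩
      · rw [firstBlock_of_notMem hw] at h
        exact .inl ⟨hw, h⟩
  last c P hP := by
    have hn := (IsStarFreePred.mem c).not.and hP
    refine (hn.or ((IsStarFreePred.const True).concat_cons c hn)).congr fun w => ?_
    constructor
    · rintro (⟨hw, h⟩ | ⟨x, y, -, ⟨hy, h⟩, rfl⟩)
      · rwa [lastBlock_of_notMem hw]
      · rwa [lastBlock_append_cons x hy]
    · intro h
      by_cases hw : c ∈ w
      · obtain ⟨u, hu⟩ := exists_eq_append_cons_lastBlock hw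
        exact .inr ⟨u, _, trivial, ⟨notMem_lastBlock w, h⟩, hu.symm⟩
      · rw [lastBlock_of_notMem hw] at h
        exact .inl ⟨hw, h⟩
  middle {A T} _ _ _ c β P hβ hP := by
    obtain ⟨e, he⟩ := hP
    have hn := (IsStarFreePred.mem c).not
    -- A word containing `c` has the form `u ++ c :: (x ++ y)` with `u`, `y` free of `c` and `x`
    -- terminated; its middle blocks are those of `c :: x`.
    have hmid := hn.concat_cons c ((IsStarFreePred.terminatedBy_and_lang c hβ e).concat hn)
    refine ((hn.and (.const (P []))).or hmid).congr fun w => ?_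
    simp only [he]
    constructor
    · rintro (⟨hw, h⟩ | ⟨u, _, hu, ⟨x, y, ⟨hx, h⟩, hy, rfl⟩, rfl⟩)
      · rwa [middleBlocks_of_notMem hw]
      · rwa [middleBlocks_append hu, hx.middleBlocks_append, middleBlocks_cons_of_notMem c hy,
          List.append_nil]
    · intro h
      by_cases hw : c ∈ w
      · obtain ⟨u, t, hu, rfl⟩ := exists_eq_append_cons_of_mem hw
        obtain ⟨x, y, hx, hy, rfl⟩ := exists_eq_terminatedBy_append (c := c) t
        rw [middleBlocks_append hu, hx.middleBlocks_append, middleBlocks_cons_of_notMem c hy,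
          List.append_nil] at h
        exact .inr ⟨u, _, hu, ⟨x, y, ⟨hx, h⟩, hy, rfl⟩, rfl⟩
      · rw [middleBlocks_of_notMem hw] at h
        exact .inl ⟨hw, h⟩

theorem RecognisedByFiniteAperiodicMonoid.isStarFree {A : Type u} [Finite A] [Nonempty A]
    {L : Language A} (hL : RecognisedByFiniteAperiodicMonoid.{u, v} L) : IsStarFree L := by
  obtain ⟨e, he⟩ := blockClosed_isStarFreePred.of_recognised hL
  exact ⟨e, Set.ext he⟩


/-! ### Temporal logic is block-closed -/

/-- Some nonempty suffix satisfies `Q`, and all longer suffixes satisfy `P`. -/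
def HoldsUntil {A : Type u} (P Q : List A → Prop) : List A → Prop
  | [] => False
  | a :: s => Q (a :: s) ∨ (P (a :: s) ∧ HoldsUntil P Q s)

/-- Truth of a temporal formula at the first position of a word, by recursion on suffixes. -/
def LTLFormula.Sat {A : Type u} : LTLFormula A → List A → Prop
  | .letter a => fun w => w.head? = some a
  | .and φ ψ => fun w => φ.Sat w ∧ ψ.Sat w
  | .or φ ψ => fun w => φ.Sat w ∨ ψ.Sat w
  | .not φ => fun w => ¬ φ.Sat w
  | .until φ ψ => fun w => HoldsUntil φ.Sat ψ.Sat w.tail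

section HoldsUntil

variable {A : Type u} {P Q P' Q' : List A → Prop}

lemma holdsUntil_iff {s : List A} : HoldsUntil P Q s ↔
    ∃ j < s.length, Q (s.drop j) ∧ ∀ i < j, P (s.drop i) := by
  induction s with
  | nil => simp [HoldsUntil]
  | cons a s ih =>
    rw [HoldsUntil, ih]
    constructor
    · rintro (h | ⟨h, j, hj, hQ, hP⟩)
      · exact ⟨0, by simp, h, by simp⟩
      · refine ⟨j + 1, by simpa using hj, hQ, fun i hi => ?_⟩
        cases i with
        | zero => exact h
        | succ i => exact hP i (by omega)
    · rintro ⟨j, hj, hQ, hP⟩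
      cases j with
      | zero => exact .inl hQ
      | succ j =>
        exact .inr ⟨hP 0 (by omega), j, by simpa using hj, hQ, fun i hi => hP (i + 1) (by omega)⟩

lemma holdsUntil_congr (hP : ∀ w, w ≠ [] → (P w ↔ P' w)) (hQ : ∀ w, w ≠ [] → (Q w ↔ Q' w))
    (s : List A) : HoldsUntil P Q s ↔ HoldsUntil P' Q' s := by
  induction s with
  | nil => rfl
  | cons a s ih => rw [HoldsUntil, HoldsUntil, ih, hP _ (by simp), hQ _ (by simp)]

lemma mem_of_holdsUntil {c : A} (hQ : ∀ w, Q w → w.head? = some c) {s : List A}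
    (h : HoldsUntil P Q s) : c ∈ s := by
  induction s with
  | nil => exact h.elim
  | cons a s ih =>
    rcases h with h | h
    · obtain rfl : a = c := by simpa using hQ _ h
      exact List.mem_cons_self
    · exact List.mem_cons_of_mem _ (ih h.2)

end HoldsUntil

/-- Until looks only to the future, so truth at a position depends only on the suffix starting
there. -/
lemma LTLFormula.holds_iff_sat {A : Type u} {w : List A} (φ : LTLFormula A) (x : Fin w.length) :
    φ.Holds w x ↔ φ.Sat (w.drop x) := by
  induction φ generalizing x with
  | letter a => simp [LTLFormula.Holds, LTLFormula.Sat, List.head?_drop]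
  | and φ ψ ihφ ihψ => simp [LTLFormula.Holds, LTLFormula.Sat, ihφ, ihψ]
  | or φ ψ ihφ ihψ => simp [LTLFormula.Holds, LTLFormula.Sat, ihφ, ihψ]
  | not φ ih => simp [LTLFormula.Holds, LTLFormula.Sat, ih]
  | _ φ ψ ihφ ihψ =>
    -- Strictness puts the offset at `x + 1`: the witness `y` corresponds to `j = y - (x + 1)`.
    simp only [LTLFormula.Holds, LTLFormula.Sat, ihφ, ihψ, List.tail_drop, holdsUntil_iff,
      List.drop_drop, List.length_drop]
    constructor
    · rintro ⟨y, hxy, hy, hz⟩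
      have hxy' : (x : ℕ) < y := hxy
      refine ⟨y - (x + 1), by omega, by rwa [show (x : ℕ) + 1 + (y - (x + 1)) = y by omega],
        fun i hi => ?_⟩
      exact hz ⟨x + 1 + i, by omega⟩ (Fin.mk_lt_mk.mpr (by omega)) (Fin.mk_lt_mk.mpr (by omega))
    · rintro ⟨j, hj, hQ, hP⟩
      refine ⟨⟨x + 1 + j, by omega⟩, Fin.mk_lt_mk.mpr (by omega), hQ, fun z hxz hzj => ?_⟩
      have hxz' : (x : ℕ) < z := hxz
      have hzj' : (z : ℕ) < x + 1 + j := hzj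
      have := hP (z - (x + 1)) (by omega)
      rwa [show (x : ℕ) + 1 + (z - (x + 1)) = z by omega] at this

/-- The predicate `P` on words agrees on nonempty words with some temporal formula. -/
def IsLTLPred (A : Type u) (P : List A → Prop) : Prop :=
  ∃ φ : LTLFormula A, ∀ w, w ≠ [] → (P w ↔ φ.Sat w)

open Classical in
/-- The suffix of a word that starts with the first occurrence of `c`. -/
noncomputable def fromFirst {A : Type u} (c : A) : List A → List A
  | [] => []
  | a :: s => if a = c then a :: s else fromFirst c s

lemma fromFirst_of_notMem {A : Type u} {c : A} {w : List A} (h : c ∉ w) :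
    fromFirst c w = [] := by
  induction w with
  | nil => rfl
  | cons a s ih =>
    simp only [List.mem_cons, not_or] at h
    simp [fromFirst, Ne.symm h.1, ih h.2]

lemma exists_fromFirst_eq_cons {A : Type u} {c : A} {w : List A} (h : c ∈ w) :
    ∃ s, fromFirst c w = c :: s := by
  induction w with
  | nil => simp at h
  | cons a s ih =>
    by_cases ha : a = c
    · exact ⟨s, by simp [fromFirst, ha]⟩
    · simpa [fromFirst, ha] using ih (by simpa [Ne.symm ha] using h)

lemma middleBlocks_fromFirst {A T : Type u} {c : A} {β : List A → T} (w : List A) :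
    middleBlocks c β (fromFirst c w) = middleBlocks c β w := by
  induction w with
  | nil => rfl
  | cons a s ih =>
    by_cases ha : a = c
    · simp [fromFirst, ha]
    · simp [fromFirst, ha, middleBlocks_cons_of_ne ha, ih]

namespace IsLTLPred

variable {A : Type u} {P Q : List A → Prop}

lemma congr (hP : IsLTLPred A P) (h : ∀ a s, P (a :: s) ↔ Q (a :: s)) : IsLTLPred A Q := by
  obtain ⟨φ, hφ⟩ := hP
  refine ⟨φ, fun w hw => ?_⟩
  rw [← hφ w hw]
  cases w with
  | nil => exact (hw rfl).elim
  | cons a s => exact (h a s).symm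

lemma sat (φ : LTLFormula A) : IsLTLPred A φ.Sat := ⟨φ, fun _ _ => Iff.rfl⟩

lemma head (a : A) : IsLTLPred A (fun w => w.head? = some a) := sat (.letter a)

lemma not (hP : IsLTLPred A P) : IsLTLPred A (fun w => ¬ P w) := by
  obtain ⟨φ, hφ⟩ := hP
  exact ⟨.not φ, fun w hw => not_congr (hφ w hw)⟩

lemma or (hP : IsLTLPred A P) (hQ : IsLTLPred A Q) : IsLTLPred A (fun w => P w ∨ Q w) := by
  obtain ⟨φ, hφ⟩ := hP
  obtain ⟨ψ, hψ⟩ := hQ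
  exact ⟨.or φ ψ, fun w hw => or_congr (hφ w hw) (hψ w hw)⟩

lemma and (hP : IsLTLPred A P) (hQ : IsLTLPred A Q) : IsLTLPred A (fun w => P w ∧ Q w) := by
  obtain ⟨φ, hφ⟩ := hP
  obtain ⟨ψ, hψ⟩ := hQ
  exact ⟨.and φ ψ, fun w hw => and_congr (hφ w hw) (hψ w hw)⟩

lemma holdsUntil_tail (hP : IsLTLPred A P) (hQ : IsLTLPred A Q) :
    IsLTLPred A (fun w => HoldsUntil P Q w.tail) := by
  obtain ⟨φ, hφ⟩ := hP
  obtain ⟨ψ, hψ⟩ := hQ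
  exact ⟨.until φ ψ, fun w _ => holdsUntil_congr hφ hψ w.tail⟩

lemma const [Nonempty A] (p : Prop) : IsLTLPred A (fun _ => p) := by
  have a := Classical.arbitrary A
  by_cases hp : p
  · exact ((head a).or (head a).not).congr fun _ _ => iff_of_true (em _) hp
  · exact ((head a).and (head a).not).congr fun _ _ => iff_of_false (fun h => h.2 h.1) hp

/-- With strict until, "next" is false until `P`. Formulas say nothing about the empty word, so an
empty tail is detected separately and given the constant value `P []`. -/
lemma tail [Nonempty A] (hP : IsLTLPred A P) : IsLTLPred A (fun w => P w.tail) := by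
  have hT := holdsUntil_tail (A := A) (const True) (const True)
  have hN := (const False).holdsUntil_tail hP
  refine ((hT.not.and (const (P []))).or hN).congr fun a s => ?_
  cases s <;> simp [HoldsUntil]

lemma mem_tail [Nonempty A] (c : A) : IsLTLPred A (fun w => c ∈ w.tail) := by
  refine ((const True).holdsUntil_tail (head c)).congr fun a s => ?_
  rw [List.tail_cons]
  refine ⟨mem_of_holdsUntil fun _ => id, fun h => ?_⟩
  induction s with
  | nil => simp at h
  | cons b s ih =>
    rcases List.mem_cons.mp h with rfl | h
    · exact .inl rfl
    · exact .inr ⟨trivial, ih h⟩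

lemma mem [Nonempty A] (c : A) : IsLTLPred A (fun w => c ∈ w) :=
  ((head c).or (mem_tail c)).congr fun a s => by simp [eq_comm]

lemma holdsUntil [Nonempty A] (hP : IsLTLPred A P) (hQ : IsLTLPred A Q) :
    IsLTLPred A (HoldsUntil P Q) :=
  (hQ.or (hP.and (hP.holdsUntil_tail hQ))).congr fun _ _ => Iff.rfl

/-- Relativisation: requiring "not `c`" in both arguments of until keeps the search before the first
`c`. -/
lemma sat_firstBlock [Nonempty A] (c : A) (φ : LTLFormula A) :
    IsLTLPred A (fun w => φ.Sat (firstBlock c w)) := by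
  induction φ with
  | letter b =>
    refine ((head c).not.and (head b)).congr fun a s => ?_
    by_cases ha : a = c <;> simp [LTLFormula.Sat, firstBlock, ha]
  | and φ ψ ihφ ihψ => exact ihφ.and ihψ
  | or φ ψ ihφ ihψ => exact ihφ.or ihψ
  | not φ ih => exact ih.not
  | _ φ ψ ihφ ihψ =>
    have hc := (head c).not
    refine (hc.and ((hc.and ihφ).holdsUntil_tail (hc.and ihψ))).congr fun a s => ?_
    by_cases ha : a = c
    · simp [LTLFormula.Sat, firstBlock, ha, HoldsUntil]
    · simp only [LTLFormula.Sat, firstBlock_cons_of_ne ha, List.tail_cons, List.head?_cons,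
        Option.some.injEq, ha, not_false_eq_true, true_and]
      induction s with
      | nil => rfl
      | cons b s ih =>
        by_cases hb : b = c
        · simp [HoldsUntil, hb, firstBlock_cons_self]
        · rw [HoldsUntil, ih]
          simp [firstBlock_cons_of_ne hb, hb, HoldsUntil]

lemma first [Nonempty A] (c : A) (hP : IsLTLPred A P) :
    IsLTLPred A (fun w => P (firstBlock c w)) := by
  obtain ⟨φ, hφ⟩ := hP
  refine (((head c).and (const (P []))).or ((head c).not.and (sat_firstBlock c φ))).congr
    fun a s => ?_
  by_cases ha : a = c
  · simp [ha, firstBlock_cons_self]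
  · rw [firstBlock_cons_of_ne ha, hφ (a :: firstBlock c s) (by simp)]
    simp [ha]

lemma last [Nonempty A] (c : A) (hP : IsLTLPred A P) :
    IsLTLPred A (fun w => P (lastBlock c w)) := by
  -- This identifies the last `c` and evaluates `P` just after it.
  have hR := (head c).and ((mem_tail c).not.and hP.tail)
  refine (((mem c).not.and hP).or ((const True).holdsUntil hR)).congr fun a s => ?_
  generalize a :: s = w
  by_cases hw : c ∈ w
  · simp only [hw, not_true, false_and, false_or]
    induction w with
    | nil => simp at hw
    | cons a s ih =>
      rw [HoldsUntil]
      by_cases hs : c ∈ s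
      · rw [ih hs, lastBlock_cons_of_mem a hs]
        simp [hs]
      · obtain rfl : c = a := by simpa [hs] using hw
        rw [show lastBlock c (c :: s) = s from lastBlock_append_cons [] hs]
        have : ¬ HoldsUntil (fun _ => True)
            (fun w => w.head? = some c ∧ ¬ c ∈ w.tail ∧ P w.tail) s :=
          fun h => hs (mem_of_holdsUntil (fun _ h => h.1) h)
        simp [this, hs]
  · have : ¬ HoldsUntil (fun _ => True)
        (fun w => w.head? = some c ∧ ¬ c ∈ w.tail ∧ P w.tail) w :=
      fun h => hw (mem_of_holdsUntil (fun _ h => h.1) h)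
    simp [hw, this, lastBlock_of_notMem hw]

lemma comp_fromFirst [Nonempty A] (c : A) (hP : IsLTLPred A P) :
    IsLTLPred A (fun w => P (fromFirst c w)) := by
  have hU := (head c).not.holdsUntil ((head c).and hP)
  refine (((mem c).not.and (const (P []))).or hU).congr fun a s => ?_
  generalize a :: s = w
  by_cases hw : c ∈ w
  · simp only [hw, not_true, false_and, false_or]
    induction w with
    | nil => simp at hw
    | cons a s ih =>
      rw [HoldsUntil]
      by_cases ha : a = c
      · simp [fromFirst, ha]
      · rw [ih (by simpa [Ne.symm ha] using hw)]
        simp [fromFirst, ha]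
  · have : ¬ HoldsUntil (fun w => ¬ w.head? = some c) (fun w => w.head? = some c ∧ P w) w :=
      fun h => hw (mem_of_holdsUntil (fun _ h => h.1) h)
    simp [hw, this, fromFirst_of_notMem hw]

/-- Formulas over the alphabet of block values lift to the positions labelled `c` that are followed
by another occurrence of `c`. -/
lemma exists_lift [Nonempty A] {T : Type u} (c : A) {β : List A → T}
    (hβ : ∀ t, IsLTLPred A (fun w => β w = t)) (φ : LTLFormula T) :
    ∃ P, IsLTLPred A P ∧
      ∀ s, c ∈ s → (P (c :: s) ↔ φ.Sat (middleBlocks c β (c :: s))) := by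
  induction φ with
  | letter t =>
    refine ⟨_, ((hβ t).first c).tail, fun s hs => ?_⟩
    simp [LTLFormula.Sat, middleBlocks_cons_self_of_mem hs]
  | and φ ψ ihφ ihψ =>
    obtain ⟨P, hP, hPφ⟩ := ihφ
    obtain ⟨Q, hQ, hQψ⟩ := ihψ
    exact ⟨_, hP.and hQ, fun s hs => and_congr (hPφ s hs) (hQψ s hs)⟩
  | or φ ψ ihφ ihψ =>
    obtain ⟨P, hP, hPφ⟩ := ihφ
    obtain ⟨Q, hQ, hQψ⟩ := ihψ
    exact ⟨_, hP.or hQ, fun s hs => or_congr (hPφ s hs) (hQψ s hs)⟩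
  | not φ ih =>
    obtain ⟨P, hP, hPφ⟩ := ih
    exact ⟨_, hP.not, fun s hs => not_congr (hPφ s hs)⟩
  | _ φ ψ ihφ ihψ =>
    obtain ⟨P, hP, hPφ⟩ := ihφ
    obtain ⟨Q, hQ, hQψ⟩ := ihψ
    -- Positions not labelled `c` are passed over. The last `c` opens no middle block, so it must
    -- not count as a witness.
    refine ⟨_, ((head c).not.or ((mem_tail c).and hP)).holdsUntil_tail
      ((head c).and ((mem_tail c).and hQ)), fun s hs => ?_⟩
    rw [middleBlocks_cons_self_of_mem hs]
    simp only [LTLFormula.Sat, List.tail_cons]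
    -- The induction runs over all suffixes, including those without `c`.
    clear hs
    induction s with
    | nil => rfl
    | cons a s ih =>
      rw [HoldsUntil, ih]
      by_cases ha : a = c
      · subst ha
        by_cases hs : a ∈ s
        · simp only [List.head?_cons, List.tail_cons, hs, true_and, hQψ s hs, hPφ s hs,
            not_true, false_or]
          rw [middleBlocks_cons_self_of_mem hs, HoldsUntil]
        · simp [hs, middleBlocks_cons_of_notMem, HoldsUntil]
      · simp [ha, middleBlocks_cons_of_ne ha]

lemma middle [Nonempty A] {T : Type u} (c : A) {β : List A → T}
    (hβ : ∀ t, IsLTLPred A (fun w => β w = t)) {P : List T → Prop} (hP : IsLTLPred T P) :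
    IsLTLPred A (fun w => P (middleBlocks c β w)) := by
  obtain ⟨φ, hφ⟩ := hP
  obtain ⟨Q, hQ, hQφ⟩ := exists_lift c hβ φ
  have hm := mem_tail c
  -- Jump to the first `c`; if no second `c` follows, the block word is empty and `φ` gives no
  -- information about it.
  refine (comp_fromFirst c ((hm.not.and (const (P []))).or (hm.and hQ))).congr fun a s => ?_
  generalize a :: s = w
  rw [← middleBlocks_fromFirst w]
  by_cases hw : c ∈ w
  · obtain ⟨s, hs⟩ := exists_fromFirst_eq_cons hw
    rw [hs, List.tail_cons]
    by_cases hcs : c ∈ s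
    · rw [hφ (middleBlocks c β (c :: s)) (by simp [middleBlocks_cons_self_of_mem hcs]),
        ← hQφ s hcs]
      simp [hcs]
    · simp [hcs, middleBlocks_cons_of_notMem]
  · simp [fromFirst_of_notMem hw, middleBlocks]

end IsLTLPred

theorem blockClosed_isLTLPred : BlockClosed.{u} IsLTLPred where
  not := IsLTLPred.not
  or := IsLTLPred.or
  mem := IsLTLPred.mem
  first c _ hP := hP.first c
  last c _ hP := hP.last c
  middle c _ _ hβ hP := IsLTLPred.middle c hβ hP

theorem RecognisedByFiniteAperiodicMonoid.isLTLDefinable {A : Type u} [Finite A] [Nonempty A]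
    {L : Language A} (hL : RecognisedByFiniteAperiodicMonoid.{u, v} L) : IsLTLDefinable L := by
  obtain ⟨φ, hφ⟩ := blockClosed_isLTLPred.of_recognised hL
  exact ⟨φ, fun w hw => (hφ w hw).trans (by rw [LTLFormula.holds_iff_sat, List.drop_zero])⟩


/-! ### Aperiodic monoids and the product for factorisations around a letter -/

lemma isAperiodic_of_stable {M : Type v} [Monoid M] (h : ∀ a : M, ∃ n : ℕ, a ^ n = a ^ n * a) :
    IsAperiodic M := by
  intro a
  obtain ⟨n, hn⟩ := h a
  have hs : a ^ (n + 1) = a ^ (n + 1) * a := by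
    conv_lhs => rw [pow_succ', hn, ← mul_assoc, ← pow_succ']
  have hk : ∀ k : ℕ, a ^ (n + 1) * a ^ k = a ^ (n + 1) := by
    intro k
    induction k with
    | zero => simp
    | succ k ih => rw [pow_succ a k, ← mul_assoc, ih, ← hs]
  -- The exponent `n + 1` ensures positivity, as `n` may be zero.
  exact ⟨n + 1, by omega, hk (n + 1), hs⟩

lemma pow_add_eq_of_stable {M : Type v} [Monoid M] {a : M} {n : ℕ} (h : a ^ n = a ^ n * a)
    {i : ℕ} (hi : n ≤ i) : a ^ (i + 1) = a ^ i := by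
  obtain ⟨k, rfl⟩ := Nat.exists_eq_add_of_le hi
  rw [show n + k + 1 = k + (n + 1) by omega, pow_add, pow_succ, ← h, ← pow_add, add_comm]

/-- A Schützenberger product of two monoids, which records the images of the factorisations of a
word around a letter. -/
@[ext]
structure LetterProduct (A : Type u) (M N : Type v) : Type (max u v) where
  left : M
  right : N
  splits : Set (M × A × N)

namespace LetterProduct

variable {A : Type u} {M N : Type v} [Monoid M] [Monoid N]

/-- In a concatenation the distinguished letter lies in one of the two factors; the other factor
multiplies the outer context. -/
instance : Monoid (LetterProduct A M N) where
  mul x y := ⟨x.left * y.left, x.right * y.right,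
    Set.image (fun p => (p.1, p.2.1, p.2.2 * y.right)) x.splits ∪
      Set.image (fun p => (x.left * p.1, p.2.1, p.2.2)) y.splits⟩
  one := ⟨1, 1, ∅⟩
  mul_assoc x y z := by
    refine LetterProduct.ext (mul_assoc _ _ _) (mul_assoc _ _ _) ?_
    change Set.image _ (Set.image _ x.splits ∪ Set.image _ y.splits) ∪ Set.image _ z.splits =
      Set.image _ x.splits ∪ Set.image _ (Set.image _ y.splits ∪ Set.image _ z.splits)
    simp only [Set.image_union, Set.image_image, Set.union_assoc]
    congr 1
    · exact Set.image_congr fun p _ => by rw [mul_assoc]; rfl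
    · congr 1
      exact Set.image_congr fun p _ => by rw [← mul_assoc]; rfl
  one_mul x := by
    refine LetterProduct.ext (one_mul _) (one_mul _) ?_
    change Set.image _ ∅ ∪ Set.image (fun p => (1 * p.1, p.2.1, p.2.2)) x.splits = x.splits
    simp
  mul_one x := by
    refine LetterProduct.ext (mul_one _) (mul_one _) ?_
    change Set.image (fun p => (p.1, p.2.1, p.2.2 * 1)) x.splits ∪ Set.image _ ∅ = x.splits
    simp

lemma mul_left' (x y : LetterProduct A M N) : (x * y).left = x.left * y.left := rfl

lemma mul_right' (x y : LetterProduct A M N) : (x * y).right = x.right * y.right := rfl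

lemma mem_splits_mul {x y : LetterProduct A M N} {m : M} {a : A} {n : N} :
    (m, a, n) ∈ (x * y).splits ↔ (∃ n', (m, a, n') ∈ x.splits ∧ n' * y.right = n) ∨
      ∃ m', (m', a, n) ∈ y.splits ∧ x.left * m' = m := by
  change _ ∈ Set.image _ x.splits ∪ Set.image _ y.splits ↔ _
  simp [Prod.ext_iff]

instance [Finite A] [Finite M] [Finite N] : Finite (LetterProduct A M N) :=
  Finite.of_injective (fun x => (x.left, x.right, x.splits))
    fun x y h => by
      simp only [Prod.mk.injEq] at h
      exact LetterProduct.ext h.1 h.2.1 h.2.2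

lemma pow_left (x : LetterProduct A M N) (k : ℕ) : (x ^ k).left = x.left ^ k := by
  induction k with
  | zero => simp; rfl
  | succ k ih => rw [pow_succ, pow_succ, mul_left', ih]

lemma pow_right (x : LetterProduct A M N) (k : ℕ) : (x ^ k).right = x.right ^ k := by
  induction k with
  | zero => simp; rfl
  | succ k ih => rw [pow_succ, pow_succ, mul_right', ih]

lemma mem_splits_pow {x : LetterProduct A M N} {k : ℕ} {m : M} {a : A} {n : N} :
    (m, a, n) ∈ (x ^ k).splits ↔ ∃ i j m' n', i + j + 1 = k ∧ (m', a, n') ∈ x.splits ∧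
      x.left ^ i * m' = m ∧ n' * x.right ^ j = n := by
  induction k generalizing m n with
  | zero => simp; exact fun h => h
  | succ k ih =>
    rw [pow_succ', mem_splits_mul, pow_right]
    constructor
    · rintro (⟨n', h, rfl⟩ | ⟨m', h, rfl⟩)
      · exact ⟨0, k, m, n', by omega, h, by simp, rfl⟩
      · obtain ⟨i, j, m'', n', hij, hm, rfl, rfl⟩ := ih.mp h
        exact ⟨i + 1, j, m'', n', by omega, hm, by rw [pow_succ', mul_assoc], rfl⟩
    · rintro ⟨i, j, m', n', hij, h, rfl, rfl⟩
      cases i with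
      | zero => exact .inl ⟨n', by simpa using h, by rw [show j = k by omega]⟩
      | succ i =>
        exact .inr ⟨x.left ^ i * m', ih.mpr ⟨i, j, m', n', by omega, h, rfl, rfl⟩,
          by rw [pow_succ', mul_assoc]⟩

/-- A split of a power has `i` factors left and `j` right of the one holding the letter. If `i + j =
r + t`, then `r ≤ i` or `t ≤ j`, so a factor can be added on a side that is already stable; removal
from the next power is similar. -/
lemma isAperiodic (hM : IsAperiodic M) (hN : IsAperiodic N) :
    IsAperiodic (LetterProduct A M N) := by
  refine isAperiodic_of_stable fun x => ?_
  obtain ⟨r, -, -, hr⟩ := hM x.left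
  obtain ⟨t, -, -, ht⟩ := hN x.right
  refine ⟨r + t + 1, ?_⟩
  rw [← pow_succ]
  refine LetterProduct.ext ?_ ?_ ?_
  · rw [pow_left, pow_left, pow_add_eq_of_stable hr (i := r + t + 1) (by omega)]
  · rw [pow_right, pow_right, pow_add_eq_of_stable ht (i := r + t + 1) (by omega)]
  · ext ⟨m, a, n⟩
    rw [mem_splits_pow, mem_splits_pow]
    constructor
    · rintro ⟨i, j, m', n', hij, h, rfl, rfl⟩
      by_cases hi : r ≤ i
      · exact ⟨i + 1, j, m', n', by omega, h, by rw [pow_add_eq_of_stable hr hi], rfl⟩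
      · exact ⟨i, j + 1, m', n', by omega, h, rfl, by rw [pow_add_eq_of_stable ht (by omega)]⟩
    · rintro ⟨i, j, m', n', hij, h, rfl, rfl⟩
      by_cases hi : r < i
      · refine ⟨i - 1, j, m', n', by omega, h, ?_, rfl⟩
        rw [← pow_add_eq_of_stable hr (i := i - 1) (by omega), Nat.sub_add_cancel (by omega)]
      · refine ⟨i, j - 1, m', n', by omega, h, rfl, ?_⟩
        rw [← pow_add_eq_of_stable ht (i := j - 1) (by omega), Nat.sub_add_cancel (by omega)]

/-- The homomorphism to the product induced by homomorphisms to its two factors. -/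
def hom (h : FreeMonoid A →* M) (k : FreeMonoid A →* N) :
    FreeMonoid A →* LetterProduct A M N :=
  FreeMonoid.lift fun a => ⟨h (.of a), k (.of a), {(1, a, 1)}⟩

lemma hom_cons (h : FreeMonoid A →* M) (k : FreeMonoid A →* N) (a : A) (w : List A) :
    hom h k (.ofList (a :: w)) = ⟨h (.of a), k (.of a), {(1, a, 1)}⟩ * hom h k (.ofList w) := by
  rw [FreeMonoid.ofList_cons, map_mul, hom, FreeMonoid.lift_eval_of]

lemma right_hom (h : FreeMonoid A →* M) (k : FreeMonoid A →* N) (w : List A) :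
    (hom h k (.ofList w)).right = k (.ofList w) := by
  induction w with
  | nil => simp; rfl
  | cons a w ih => rw [hom_cons, mul_right', ih, FreeMonoid.ofList_cons, map_mul]

lemma mem_splits_hom (h : FreeMonoid A →* M) (k : FreeMonoid A →* N) {w : List A} {m : M} {a : A}
    {n : N} : (m, a, n) ∈ (hom h k (.ofList w)).splits ↔
      ∃ p s, w = p ++ a :: s ∧ h (.ofList p) = m ∧ k (.ofList s) = n := by
  induction w generalizing m with
  | nil => simp; exact fun h => h
  | cons b w ih =>
    rw [hom_cons, mem_splits_mul, right_hom]
    constructor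
    · rintro (⟨n', hn, rfl⟩ | ⟨m', hm, rfl⟩)
      · obtain ⟨rfl, rfl, rfl⟩ : m = 1 ∧ a = b ∧ n' = 1 := by simpa using hn
        exact ⟨[], w, rfl, by simp, by simp⟩
      · obtain ⟨p, s, rfl, rfl, hs⟩ := ih.mp hm
        exact ⟨b :: p, s, rfl, by rw [FreeMonoid.ofList_cons, map_mul], hs⟩
    · rintro ⟨p, s, hw, rfl, rfl⟩
      cases p with
      | nil =>
        obtain ⟨rfl, rfl⟩ : b = a ∧ w = s := by simpa using hw
        exact .inl ⟨1, by simp, by simp⟩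
      | cons b' p =>
        obtain ⟨rfl, rfl⟩ : b = b' ∧ w = p ++ a :: s := by simpa using hw
        exact .inr ⟨h (.ofList p), ih.mpr ⟨p, s, rfl, rfl, rfl⟩,
          by rw [FreeMonoid.ofList_cons, map_mul]⟩

end LetterProduct

/-! ### From star-free expressions to aperiodic monoids -/

/-- The predicate `P` on words is recognised by a finite aperiodic monoid. -/
def IsAperiodicPred (A : Type u) (P : List A → Prop) : Prop :=
  ∃ (M : Type u) (_ : Monoid M) (_ : Finite M) (_ : IsAperiodic M) (h : FreeMonoid A →* M)
    (F : M → Prop), ∀ w : List A, P w ↔ F (h (.ofList w))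

namespace IsAperiodicPred

variable {A : Type u} {P Q : List A → Prop}

lemma congr (hP : IsAperiodicPred A P) (h : ∀ w, P w ↔ Q w) : IsAperiodicPred A Q := by
  rwa [← funext fun w => propext (h w)]

lemma const (p : Prop) : IsAperiodicPred A (fun _ => p) :=
  ⟨PUnit, inferInstance, inferInstance, isAperiodic_of_stable fun _ => ⟨0, rfl⟩, 1, fun _ => p,
    fun _ => Iff.rfl⟩

lemma not (hP : IsAperiodicPred A P) : IsAperiodicPred A (fun w => ¬ P w) := by
  obtain ⟨M, i, j, hM, h, F, hF⟩ := hP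
  exact ⟨M, i, j, hM, h, fun m => ¬ F m, fun w => not_congr (hF w)⟩

lemma or (hP : IsAperiodicPred A P) (hQ : IsAperiodicPred A Q) :
    IsAperiodicPred A (fun w => P w ∨ Q w) := by
  obtain ⟨M, _, _, hM, h, F, hF⟩ := hP
  obtain ⟨N, _, _, hN, k, G, hG⟩ := hQ
  refine ⟨M × N, inferInstance, inferInstance, isAperiodic_of_stable fun x => ?_, h.prod k,
    fun x => F x.1 ∨ G x.2, fun w => or_congr (hF w) (hG w)⟩
  obtain ⟨r, -, -, hr⟩ := hM x.1
  obtain ⟨t, -, -, ht⟩ := hN x.2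
  refine ⟨r + t, ?_⟩
  rw [← pow_succ]
  refine Prod.ext ?_ ?_
  · exact (pow_add_eq_of_stable hr (by omega)).symm
  · exact (pow_add_eq_of_stable ht (by omega)).symm

lemma comap {B : Type u} {P : List B → Prop} (hP : IsAperiodicPred B P) (f : A → B) :
    IsAperiodicPred A (fun w => P (w.map f)) := by
  obtain ⟨M, i, j, hM, h, F, hF⟩ := hP
  exact ⟨M, i, j, hM, h.comp (FreeMonoid.map f), F, fun w => hF (w.map f)⟩

/-- The relation `G` may tie prefix, letter and suffix together; the quantifier step of first-order
logic needs this generality. -/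
lemma exists_split [Finite A] {M N : Type u} [Monoid M] [Monoid N] [Finite M] [Finite N]
    (hM : IsAperiodic M) (hN : IsAperiodic N) (h : FreeMonoid A →* M) (k : FreeMonoid A →* N)
    (G : M → A → N → Prop) :
    IsAperiodicPred A
      (fun w => ∃ p a s, w = p ++ a :: s ∧ G (h (.ofList p)) a (k (.ofList s))) := by
  refine ⟨LetterProduct A M N, inferInstance, inferInstance, LetterProduct.isAperiodic hM hN,
    LetterProduct.hom h k, fun x => ∃ m a n, (m, a, n) ∈ x.splits ∧ G m a n, fun w => ?_⟩
  simp only [LetterProduct.mem_splits_hom]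
  constructor
  · rintro ⟨p, a, s, hw, hG⟩
    exact ⟨_, a, _, ⟨p, s, hw, rfl, rfl⟩, hG⟩
  · rintro ⟨_, a, _, ⟨p, s, hw, rfl, rfl⟩, hG⟩
    exact ⟨p, a, s, hw, hG⟩

lemma exists_split_and [Finite A] (hP : IsAperiodicPred A P) (g : A → Prop)
    (hQ : IsAperiodicPred A Q) :
    IsAperiodicPred A (fun w => ∃ p a s, w = p ++ a :: s ∧ P p ∧ g a ∧ Q s) := by
  obtain ⟨M, _, _, hM, h, F, hF⟩ := hP
  obtain ⟨N, _, _, hN, k, G, hG⟩ := hQ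
  simpa only [hF, hG] using exists_split hM hN h k fun m a n => F m ∧ g a ∧ G n

lemma exists_mem [Finite A] (g : A → Prop) : IsAperiodicPred A (fun w => ∃ a ∈ w, g a) := by
  refine ((const True).exists_split_and g (const True)).congr fun w => ?_
  simp only [true_and, and_true, List.mem_iff_append]
  grind

lemma eq_nil [Finite A] : IsAperiodicPred A (fun w => w = []) :=
  (exists_mem fun _ => True).not.congr fun w => by simp [List.eq_nil_iff_forall_not_mem]

lemma concat [Finite A] (hP : IsAperiodicPred A P) (hQ : IsAperiodicPred A Q) :
    IsAperiodicPred A (fun w => ∃ x y, P x ∧ Q y ∧ x ++ y = w) := by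
  have hnil : IsAperiodicPred A (fun w => P w ∧ Q []) := by
    by_cases h : Q []
    · simpa [h] using hP
    · simpa [h] using const False
  obtain ⟨M, _, _, hM, h, F, hF⟩ := hP
  obtain ⟨N, _, _, hN, k, G, hG⟩ := hQ
  -- A nonempty right factor is split off around its first letter; an empty one is `hnil`.
  refine (hnil.or (exists_split hM hN h k fun m a n => F m ∧ G (k (.of a) * n))).congr fun w => ?_
  constructor
  · rintro (⟨hw, hQ⟩ | ⟨p, a, s, rfl, hp, hs⟩)
    · exact ⟨w, [], hw, hQ, by simp⟩
    · exact ⟨p, a :: s, (hF p).mpr hp, (hG _).mpr (by rwa [FreeMonoid.ofList_cons, map_mul]), rfl⟩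
  · rintro ⟨x, y, hx, hy, rfl⟩
    cases y with
    | nil => exact .inl ⟨by simpa using hx, hy⟩
    | cons a s =>
      refine .inr ⟨x, a, s, rfl, (hF x).mp hx, ?_⟩
      rwa [hG, FreeMonoid.ofList_cons, map_mul] at hy

lemma recognised {L : Language A} (hL : IsAperiodicPred A (fun w => w ∈ L)) :
    RecognisedByFiniteAperiodicMonoid.{u, v} L := by
  obtain ⟨M, _, _, hM, h, F, hF⟩ := hL
  let e : Shrink.{v} M ≃* M := Shrink.mulEquiv
  refine ⟨Shrink.{v} M, inferInstance, inferInstance, isAperiodic_of_stable fun x => ?_,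
    e.symm.toMonoidHom.comp h, {m | F (e m)}, fun w => ?_⟩
  · obtain ⟨n, -, -, hn⟩ := hM (e x)
    exact ⟨n, e.injective (by simpa using hn)⟩
  · exact (hF w).trans (by simp)

end IsAperiodicPred

theorem IsStarFree.recognised {A : Type u} [Finite A] {L : Language A} (hL : IsStarFree L) :
    RecognisedByFiniteAperiodicMonoid.{u, v} L := by
  obtain ⟨e, rfl⟩ := hL
  apply IsAperiodicPred.recognised
  induction e with
  | letter a =>
    refine (IsAperiodicPred.eq_nil.exists_split_and (fun b => b = a) .eq_nil).congr fun w => ?_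
    change _ ↔ w = [a]
    constructor
    · rintro ⟨_, _, _, rfl, rfl, rfl, rfl⟩
      rfl
    · rintro rfl
      exact ⟨[], a, [], rfl, rfl, rfl, rfl⟩
  | empty => exact (IsAperiodicPred.const False).congr fun w => iff_of_false id fun h => h
  | concat e f ihe ihf =>
    refine (ihe.concat ihf).congr fun w => ?_
    simp only [StarFreeExpr.lang, Language.mem_mul]
    grind
  | union e f ihe ihf => exact ihe.or ihf
  | compl e ih => exact ih.not


/-! ### From first-order logic to aperiodic monoids -/

open FirstOrder FirstOrder.Language

/-- The word `w` in which every position also carries the set of variables assigned to it. -/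
noncomputable def markedWord {A : Type u} {n : ℕ} (w : List A) (xs : Fin n → Fin w.length) :
    List (A × Set (Fin n)) :=
  List.ofFn fun i => (w.get i, {j | xs j = i})

section MarkedWord

variable {A : Type u} {n : ℕ} {w : List A}

@[simp]
lemma length_markedWord (xs : Fin n → Fin w.length) : (markedWord w xs).length = w.length := by
  simp [markedWord]

lemma getElem_markedWord (xs : Fin n → Fin w.length) (i : ℕ) (hi : i < (markedWord w xs).length) :
    (markedWord w xs)[i] = (w.get ⟨i, by simpa using hi⟩, {j | (xs j : ℕ) = i}) := by
  simp [markedWord, Fin.ext_iff]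

lemma exists_mem_markedWord {xs : Fin n → Fin w.length} {g : A × Set (Fin n) → Prop} :
    (∃ a ∈ markedWord w xs, g a) ↔ ∃ i, g (w.get i, {j | xs j = i}) := by
  simp [markedWord, List.mem_ofFn]

/-- A letter without the variable `n`. -/
def unmark (a : A × Set (Fin n)) : A × Set (Fin (n + 1)) := (a.1, Set.image Fin.castSucc a.2)

/-- A letter with the variable `n` added. -/
def mark (a : A × Set (Fin n)) : A × Set (Fin (n + 1)) :=
  (a.1, insert (Fin.last n) (Set.image Fin.castSucc a.2))

/-- The new variable affects only the letter at `y`, so choosing its value amounts to choosing a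
factorisation around a letter. -/
lemma markedWord_snoc (xs : Fin n → Fin w.length) (y : Fin w.length) :
    markedWord w (Fin.snoc xs y : Fin (n + 1) → Fin w.length) =
      ((markedWord w xs).take y).map unmark ++
        mark ((markedWord w xs)[(y : ℕ)]'(by simp)) ::
          ((markedWord w xs).drop (y + 1)).map unmark := by
  have h := List.set_eq_take_append_cons_drop (l := (markedWord w xs).map unmark) (i := y)
    (a := mark ((markedWord w xs)[(y : ℕ)]'(by simp)))
  rw [if_pos (by simp), ← List.map_take, ← List.map_drop] at h
  rw [← h]
  apply List.ext_getElem (by simp)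
  intro i h₁ h₂
  rw [List.getElem_set]
  split_ifs with hi
  · subst hi
    simp only [getElem_markedWord, mark]
    congr 1
    ext j
    refine Fin.lastCases ?_ (fun j => ?_) j
    · simp
    · simp [Fin.castSucc_ne_last]
  · simp only [getElem_markedWord, List.getElem_map, unmark]
    congr 1
    ext j
    refine Fin.lastCases ?_ (fun j => ?_) j
    · simp [hi, Fin.castSucc_ne_last]
    · simp

lemma exists_eq_append_cons_iff {B : Type u} {l : List B} {R : List B → B → List B → Prop} :
    (∃ p a s, l = p ++ a :: s ∧ R p a s) ↔
      ∃ i, ∃ h : i < l.length, R (l.take i) l[i] (l.drop (i + 1)) := by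
  constructor
  · rintro ⟨p, a, s, rfl, h⟩
    exact ⟨p.length, by simp, by simpa using h⟩
  · rintro ⟨i, hi, h⟩
    exact ⟨_, _, _, by simp, h⟩

end MarkedWord

/-- Every formula with free variables among the first `n` is decided on marked words by a finite
aperiodic monoid. -/
lemma exists_isAperiodicPred_realize {A : Type u} [Finite A] {n : ℕ}
    (φ : (wordVocabulary A).BoundedFormula Empty n) :
    ∃ P : List (A × Set (Fin n)) → Prop, IsAperiodicPred _ P ∧
      ∀ (w : List A) (xs : Fin n → Fin w.length),
        @BoundedFormula.Realize _ _ (orderedModel w) _ _ φ Empty.elim xs ↔ P (markedWord w xs) := by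
  have term_eq : ∀ {m : ℕ} (t : (wordVocabulary A).Term (Empty ⊕ Fin m)),
      ∃ i, t = Term.var (Sum.inr i) := by
    rintro m ((e | i) | f)
    · exact e.elim
    · exact ⟨i, rfl⟩
    · exact Empty.elim f
  -- Only words of the form `markedWord w xs` matter, so ill-formed markings never have to be
  -- excluded.
  induction φ with
  | falsum => exact ⟨_, .const False, fun w xs => Iff.rfl⟩
  | @equal n t₁ t₂ =>
    obtain ⟨i, rfl⟩ := term_eq t₁
    obtain ⟨j, rfl⟩ := term_eq t₂
    refine ⟨_, .exists_mem fun a => i ∈ a.2 ∧ j ∈ a.2, fun w xs => ?_⟩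
    rw [exists_mem_markedWord]
    change xs i = xs j ↔ _
    simp [eq_comm]
  | @rel n l R ts =>
    cases R with
    | le =>
      obtain ⟨i, hi⟩ := term_eq (ts 0)
      obtain ⟨j, hj⟩ := term_eq (ts 1)
      -- Either one letter carries both marks, or a letter marked `i` precedes one marked `j`.
      refine ⟨_, (IsAperiodicPred.exists_mem fun a => i ∈ a.2 ∧ j ∈ a.2).or
        ((IsAperiodicPred.const True).exists_split_and (fun a => i ∈ a.2)
          (.exists_mem fun a => j ∈ a.2)), fun w xs => ?_⟩
      rw [exists_mem_markedWord, exists_eq_append_cons_iff]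
      let := orderedModel w
      change (ts 0).realize (Sum.elim Empty.elim xs) ≤ (ts 1).realize (Sum.elim Empty.elim xs) ↔ _
      rw [hi, hj]
      change xs i ≤ xs j ↔ _
      constructor
      · intro hle
        rcases hle.eq_or_lt with heq | hlt
        · exact .inl ⟨xs i, rfl, heq.symm⟩
        · have hlt' : (xs i : ℕ) < xs j := hlt
          refine .inr ⟨xs i, by simp, trivial, by simp [getElem_markedWord],
            (markedWord w xs)[(xs j : ℕ)]'(by simp), ?_, by simp [getElem_markedWord]⟩
          rw [List.mem_drop_iff_getElem]
          refine ⟨xs j - (xs i + 1), by simp; omega, ?_⟩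
          congr 1
          omega
      · rintro (⟨k, hik, hjk⟩ | ⟨k, hk, -, hik, a, ha, hja⟩)
        · exact (hik.trans hjk.symm).le
        · obtain ⟨l, hl, rfl⟩ := List.mem_drop_iff_getElem.mp ha
          rw [getElem_markedWord] at hik hja
          have hik' : (xs i : ℕ) = k := hik
          have hja' : (xs j : ℕ) = k + 1 + l := hja
          exact Fin.le_def.mpr (by omega)
    | label b =>
      obtain ⟨i, hi⟩ := term_eq (ts 0)
      refine ⟨_, .exists_mem fun a => a.1 = b ∧ i ∈ a.2, fun w xs => ?_⟩
      rw [exists_mem_markedWord]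
      let := orderedModel w
      change w.get ((ts 0).realize (Sum.elim Empty.elim xs)) = b ↔ _
      rw [hi]
      change w.get (xs i) = b ↔ _
      simp
  | imp φ ψ ihφ ihψ =>
    obtain ⟨P, hP, hPφ⟩ := ihφ
    obtain ⟨Q, hQ, hQψ⟩ := ihψ
    refine ⟨_, hP.not.or hQ, fun w xs => ?_⟩
    rw [← hPφ, ← hQψ, ← imp_iff_not_or]
    rfl
  | @all n φ ih =>
    obtain ⟨P, ⟨M, _, _, hM, h, F, hF⟩, hPφ⟩ := ih
    let k : FreeMonoid (A × Set (Fin n)) →* M := h.comp (FreeMonoid.map unmark)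
    -- The quantifier says that no factorisation is a counterexample; the image of the newly marked
    -- word is the product of the three images.
    refine ⟨_, (IsAperiodicPred.exists_split hM hM k k
      fun m a m' => ¬ F (m * (h (.of (mark a)) * m'))).not, fun w xs => ?_⟩
    rw [exists_eq_append_cons_iff]
    push Not
    change (∀ y : Fin w.length, @BoundedFormula.Realize _ _ (orderedModel w) _ _ φ Empty.elim
      (Fin.snoc xs y : Fin (n + 1) → Fin w.length)) ↔ _
    simp only [hPφ, markedWord_snoc, hF]
    simp only [FreeMonoid.ofList_append, FreeMonoid.ofList_cons, map_mul]
    constructor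
    · exact fun H i hi => H ⟨i, by simpa using hi⟩
    · exact fun H y => H y (by simp)

theorem IsFODefinable.recognised {A : Type u} [Finite A] {L : Language A} (hL : IsFODefinable L) :
    RecognisedByFiniteAperiodicMonoid.{u, v} L := by
  obtain ⟨φ, hφ⟩ := hL
  obtain ⟨P, hP, h⟩ := exists_isAperiodicPred_realize φ
  apply IsAperiodicPred.recognised
  refine (hP.comap fun a => (a, (∅ : Set (Fin 0)))).congr fun w => ?_
  have key := h w default
  rw [hφ w]
  have hw : w.map (fun a => (a, (∅ : Set (Fin 0)))) = markedWord w default := by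
    apply List.ext_getElem (by simp)
    intro i h₁ h₂
    rw [getElem_markedWord]
    simp [Set.eq_empty_of_isEmpty]
  rw [hw, ← key]
  unfold Sentence.Realize Formula.Realize
  rw [Subsingleton.elim (default : Empty → Fin w.length) Empty.elim]


/-! ### From temporal logic to first-order logic -/

section

variable {A : Type u} {n : ℕ}

/-- The formula `x ≤ y`. -/
def leFormula (x y : Fin n) : (wordVocabulary A).BoundedFormula Empty n :=
  Relations.boundedFormula₂ (L := wordVocabulary A) WordRel.le (Term.var (Sum.inr x))
    (Term.var (Sum.inr y))

/-- The formula `x < y`. -/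
def ltFormula (x y : Fin n) : (wordVocabulary A).BoundedFormula Empty n :=
  ∼(leFormula y x)

/-- The formula `a(x)`. -/
def labelFormula (a : A) (x : Fin n) : (wordVocabulary A).BoundedFormula Empty n :=
  Relations.boundedFormula₁ (L := wordVocabulary A) (WordRel.label a) (Term.var (Sum.inr x))

/-- The first-order translation of a temporal formula, evaluated at the variable `x`. -/
def LTLFormula.toFO : LTLFormula A → ∀ n : ℕ, Fin n → (wordVocabulary A).BoundedFormula Empty n
  | .letter a, _, x => labelFormula a x
  | .and φ ψ, n, x => φ.toFO n x ⊓ ψ.toFO n x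
  | .or φ ψ, n, x => φ.toFO n x ⊔ ψ.toFO n x
  | .not φ, n, x => ∼(φ.toFO n x)
  | .until φ ψ, n, x =>
      ∃' (ltFormula x.castSucc (Fin.last n) ⊓ (ψ.toFO (n + 1) (Fin.last n) ⊓
        ∀' (ltFormula x.castSucc.castSucc (Fin.last (n + 1)) ⟹
          (ltFormula (Fin.last (n + 1)) (Fin.last n).castSucc ⟹
            φ.toFO (n + 2) (Fin.last (n + 1))))))

variable {w : List A}

lemma realize_leFormula (x y : Fin n) (xs : Fin n → Fin w.length) :
    @BoundedFormula.Realize _ _ (orderedModel w) _ _ (leFormula x y) Empty.elim xs ↔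
      xs x ≤ xs y := by
  let := orderedModel w
  exact BoundedFormula.realize_rel₂.trans Iff.rfl

lemma realize_ltFormula (x y : Fin n) (xs : Fin n → Fin w.length) :
    @BoundedFormula.Realize _ _ (orderedModel w) _ _ (ltFormula x y) Empty.elim xs ↔
      xs x < xs y := by
  let := orderedModel w
  rw [ltFormula, BoundedFormula.realize_not, realize_leFormula, not_le]

lemma realize_labelFormula (a : A) (x : Fin n) (xs : Fin n → Fin w.length) :
    @BoundedFormula.Realize _ _ (orderedModel w) _ _ (labelFormula a x) Empty.elim xs ↔
      w.get (xs x) = a := by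
  let := orderedModel w
  exact BoundedFormula.realize_rel₁.trans Iff.rfl

lemma LTLFormula.realize_toFO (φ : LTLFormula A) (x : Fin n) (xs : Fin n → Fin w.length) :
    @BoundedFormula.Realize _ _ (orderedModel w) _ _ (φ.toFO n x) Empty.elim xs ↔
      φ.Holds w (xs x) := by
  let := orderedModel w
  induction φ generalizing n with
  | letter a => exact realize_labelFormula a x xs
  | and φ ψ ihφ ihψ => simp [LTLFormula.toFO, LTLFormula.Holds, ihφ, ihψ]
  | or φ ψ ihφ ihψ => simp [LTLFormula.toFO, LTLFormula.Holds, ihφ, ihψ]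
  | not φ ih => simp [LTLFormula.toFO, LTLFormula.Holds, ih]
  | _ φ ψ ihφ ihψ =>
    simp [LTLFormula.toFO, LTLFormula.Holds, ihφ, ihψ, realize_ltFormula]

end

theorem IsLTLDefinable.isFODefinable {A : Type u} {L : Language A} (hL : IsLTLDefinable L) :
    IsFODefinable L := by
  obtain ⟨φ, hφ⟩ := hL
  -- The first position is defined as the least one. The sentence is existential, hence false in the
  -- empty word.
  let atFirst : (wordVocabulary A).Sentence :=
    ∃' ((∀' leFormula 0 1) ⊓ φ.toFO 1 0)
  let isNil : (wordVocabulary A).Sentence := ∀' ⊥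
  have hNil : ∀ w : List A, @Sentence.Realize _ _ (orderedModel w) isNil ↔ w = [] := by
    intro w
    let := orderedModel w
    simp only [isNil, Sentence.Realize, Formula.Realize, BoundedFormula.realize_all,
      BoundedFormula.realize_bot]
    rw [← isEmpty_iff, ← not_nonempty_iff, ← Fin.pos_iff_nonempty, List.length_pos_iff, not_not]
  have hFirst : ∀ (w : List A) (hw : w ≠ []), @Sentence.Realize _ _ (orderedModel w) atFirst ↔
      φ.Holds w ⟨0, List.length_pos_iff.mpr hw⟩ := by
    intro w hw
    let := orderedModel w
    simp only [atFirst, Sentence.Realize, Formula.Realize, BoundedFormula.realize_ex,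
      BoundedFormula.realize_inf, BoundedFormula.realize_all]
    rw [Subsingleton.elim (default : Empty → Fin w.length) Empty.elim]
    simp only [realize_leFormula, LTLFormula.realize_toFO]
    constructor
    · rintro ⟨x, hx, h⟩
      have hx0 : x ≤ ⟨0, List.length_pos_iff.mpr hw⟩ := hx ⟨0, List.length_pos_iff.mpr hw⟩
      have : x = ⟨0, List.length_pos_iff.mpr hw⟩ := le_antisymm hx0 (Nat.zero_le _)
      subst this
      exact h
    · exact fun h => ⟨⟨0, List.length_pos_iff.mpr hw⟩, fun y => Nat.zero_le _, h⟩
  have hFirst_nil : ¬ @Sentence.Realize _ _ (orderedModel ([] : List A)) atFirst := by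
    let := orderedModel ([] : List A)
    simp only [atFirst, Sentence.Realize, Formula.Realize, BoundedFormula.realize_ex]
    rintro ⟨x, -⟩
    exact x.elim0
  -- Temporal definability ignores the empty word, so its membership is added by hand with `isNil`.
  by_cases hL : ([] : List A) ∈ L
  · refine ⟨isNil ⊔ atFirst, fun w => ?_⟩
    let := orderedModel w
    refine Iff.trans ?_ (BoundedFormula.realize_sup (φ := isNil) (ψ := atFirst)).symm
    change _ ↔ Sentence.Realize _ isNil ∨ Sentence.Realize _ atFirst
    rw [hNil]
    by_cases hw : w = []
    · simp [hw, hL]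
    · rw [hFirst w hw, hφ w hw]
      simp [hw]
  · refine ⟨atFirst, fun w => ?_⟩
    by_cases hw : w = []
    · subst hw
      exact iff_of_false hL hFirst_nil
    · rw [hFirst w hw, hφ w hw]

end WordLogic

/-! ### The equivalence -/

theorem mainTheorem1 {A : Type u} [Finite A] [Nonempty A] (L : Language A) :
    List.TFAE
      [WordLogic.RecognisedByFiniteAperiodicMonoid.{u, v} L,
        WordLogic.IsStarFree L,
        WordLogic.IsFODefinable L,
        WordLogic.IsLTLDefinable L] := by
  tfae_have 1 → 2 := WordLogic.RecognisedByFiniteAperiodicMonoid.isStarFree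
  tfae_have 2 → 1 := WordLogic.IsStarFree.recognised
  tfae_have 1 → 4 := WordLogic.RecognisedByFiniteAperiodicMonoid.isLTLDefinable
  tfae_have 4 → 3 := WordLogic.IsLTLDefinable.isFODefinable
  tfae_have 3 → 1 := WordLogic.IsFODefinable.recognised
  tfae_finish
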